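/- Let $\Bbbk=\mathbb R$ or $\mathbb C$, and let $\mathbb S^n$ be the set of $n\times n$ Hermitian matrices over $\Bbbk$ (real symmetric if $\Bbbk=\mathbb R$). For $A=(a_{ij})\in\mathbb S^n$ and $d\ge n$ put $$\lVert A\rVert_{\gamma}=\max\Bigl\{\Bigl\lvert\sum_{i,j=1}^n a_{ij}\langle x_i,x_j\rangle\Bigr\rvert : x_1,\dots,x_n\in\Bbbk^d,\ \lVert x_i\rVert=1\Bigr\},\qquad \lVert A\rVert_{\theta}=\max\Bigl\{\Bigl\lvert\sum_{i,j=1}^n a_{ij}\bar\delta_i\delta_j\Bigr\rvert : \delta_1,\dots,\delta_n\in\Bbbk,\ \lvert\delta_i\rvert=1\Bigr\},$$ where $\langle x,y\rangle=x^*y$. Let $$\operatorname{str}(A)=\max_{x\in\mathbb T^n}x^*Ax-\min_{x\in\mathbb T^n}x^*Ax,\qquad \operatorname{spr}(A)=\max_{X\in\mathbb G^n}\operatorname{tr}(AX)-\min_{X\in\mathbb G^n}\operatorname{tr}(AX),$$ where $\mathbb T^n=\{x\in\Bbbk^n:\lvert x_1\rvert=\dots=\lvert x_n\rvert=1\}$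 and $\mathbb G^n$ is the set of $n\times n$ correlation matrices, i.e. positive semidefinite matrices over $\Bbbk$ all of whose diagonal entries are $1$. **Theorem.** There is a smallest real constant $K_\gamma=K_\gamma^{\Bbbk}$ such that $\lVert A\rVert_\gamma\le K_\gamma\lVert A\rVert_\theta$ for all $n$, all $d\ge n$ and all $A\in\mathbb S^n$ (the symmetric Grothendieck constant for the $\gamma$-seminorm), and for every $n$ and every $A\in\mathbb S^n$, $$\operatorname{str}(A)\le\operatorname{spr}(A)\le K_\gamma\operatorname{str}(A).$$ -/

import Mathlib

open scoped ComplexOrder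

noncomputable section

namespace SymGrothendieck

variable (𝕜 : Type*) [RCLike 𝕜]

/-- The vectors `x ∈ 𝕜ⁿ` all of whose coordinates have modulus one
(`{-1, 1}ⁿ` when `𝕜 = ℝ`, the `n`-torus when `𝕜 = ℂ`). -/
def unimodular (n : ℕ) : Set (Fin n → 𝕜) :=
  {x | ∀ i, ‖x i‖ = 1}

/-- The `n × n` correlation matrices: positive semidefinite with unit diagonal. -/
def correlation (n : ℕ) : Set (Matrix (Fin n) (Fin n) 𝕜) :=
  {X | X.PosSemidef ∧ ∀ i, X i i = 1}

/-- The `n`-tuples of unit vectors in `𝕜ᵈ`. -/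
def unitTuples (d n : ℕ) : Set (Fin n → EuclideanSpace 𝕜 (Fin d)) :=
  {x | ∀ i, ‖x i‖ = 1}

variable {𝕜}

/-- The set of values of `x* A x` over unimodular `x`
(these values are real when `A` is Hermitian). -/
def quadValues {n : ℕ} (A : Matrix (Fin n) (Fin n) 𝕜) : Set ℝ :=
  (fun x : Fin n → 𝕜 => RCLike.re (star x ⬝ᵥ A.mulVec x)) '' unimodular 𝕜 n

/-- The set of values of `tr (A X)` over correlation matrices `X`
(these values are real when `A` is Hermitian). -/
def traceValues {n : ℕ} (A : Matrix (Fin n) (Fin n) 𝕜) : Set ℝ :=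
  (fun X : Matrix (Fin n) (Fin n) 𝕜 => RCLike.re (A * X).trace) '' correlation 𝕜 n

/-- The stretch of `A`: maximum minus minimum of `x* A x` over unimodular `x`. -/
def stretch {n : ℕ} (A : Matrix (Fin n) (Fin n) 𝕜) : ℝ :=
  sSup (quadValues A) - sInf (quadValues A)

/-- The spread of `A`: maximum minus minimum of `tr (A X)` over correlation matrices `X`. -/
def spread {n : ℕ} (A : Matrix (Fin n) (Fin n) 𝕜) : ℝ :=
  sSup (traceValues A) - sInf (traceValues A)

/-- The set of values of `|∑ i, ∑ j, a i j ⟨x i, x j⟩|` over unit vectors `x i ∈ 𝕜ᵈ`. -/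
def gammaValues (d : ℕ) {n : ℕ} (A : Matrix (Fin n) (Fin n) 𝕜) : Set ℝ :=
  (fun x : Fin n → EuclideanSpace 𝕜 (Fin d) => ‖∑ i, ∑ j, A i j * inner 𝕜 (x i) (x j)‖) ''
    unitTuples 𝕜 d n

/-- The set of values of `|∑ i, ∑ j, a i j conj(δ i) δ j|` over unimodular `δ`. -/
def thetaValues {n : ℕ} (A : Matrix (Fin n) (Fin n) 𝕜) : Set ℝ :=
  (fun δ : Fin n → 𝕜 => ‖∑ i, ∑ j, A i j * star (δ i) * δ j‖) '' unimodular 𝕜 n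

/-- The `(γ, d)`-seminorm. -/
def gammaSeminorm (d : ℕ) {n : ℕ} (A : Matrix (Fin n) (Fin n) 𝕜) : ℝ :=
  sSup (gammaValues d A)

/-- The `θ`-seminorm. -/
def thetaSeminorm {n : ℕ} (A : Matrix (Fin n) (Fin n) 𝕜) : ℝ :=
  sSup (thetaValues A)

variable (𝕜)

/-- The constants for which the symmetric Grothendieck inequality for the `γ`-seminorm holds,
for all sizes `n`, all `d ≥ n` and all Hermitian `A`. -/
def grothendieckConstants : Set ℝ :=
  {K | ∀ n d : ℕ, n ≤ d → ∀ A : Matrix (Fin n) (Fin n) 𝕜, A.IsHermitian →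
    gammaSeminorm d A ≤ K * thetaSeminorm A}

/-- The symmetric Grothendieck constant `K_γ`: the smallest of these constants. -/
def Kγ : ℝ := sInf (grothendieckConstants 𝕜)

/-! The suprema and infima above are maxima and minima. -/

theorem isCompact_unimodular (n : ℕ) : IsCompact (unimodular 𝕜 n) := by
  have h : unimodular 𝕜 n = Set.univ.pi fun _ : Fin n => Metric.sphere (0 : 𝕜) 1 := by
    ext x; simp [unimodular]
  rw [h]
  exact isCompact_univ_pi fun _ => isCompact_sphere _ _

theorem isCompact_unitTuples (d n : ℕ) : IsCompact (unitTuples 𝕜 d n) := by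
  have h : unitTuples 𝕜 d n =
      Set.univ.pi fun _ : Fin n => Metric.sphere (0 : EuclideanSpace 𝕜 (Fin d)) 1 := by
    ext x; simp [unitTuples]
  rw [h]
  exact isCompact_univ_pi fun _ => isCompact_sphere _ _

theorem unimodular_nonempty (n : ℕ) : (unimodular 𝕜 n).Nonempty :=
  ⟨fun _ => 1, fun _ => norm_one⟩

theorem unitTuples_nonempty {d n : ℕ} (h : n ≤ d) : (unitTuples 𝕜 d n).Nonempty :=
  ⟨fun i => EuclideanSpace.single (Fin.castLE h i) 1, fun i => by simp⟩

theorem correlation_nonempty (n : ℕ) : (correlation 𝕜 n).Nonempty :=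
  ⟨1, Matrix.PosSemidef.one, fun i => by simp⟩

/-- Correlation matrices are the Gram matrices of unit vectors. -/
theorem correlation_eq_gram (n : ℕ) :
    correlation 𝕜 n = (fun x => Matrix.gram 𝕜 x) '' unitTuples 𝕜 n n := by
  ext X
  constructor
  · rintro ⟨hX, h1⟩
    obtain ⟨B, rfl⟩ : ∃ B : Matrix (Fin n) (Fin n) 𝕜, X = B.conjTranspose * B := by
      open scoped MatrixOrder Matrix.Norms.L2Operator in
      exact CStarAlgebra.nonneg_iff_eq_star_mul_self.mp hX.nonneg
    have hg : Matrix.gram 𝕜 (fun j => (WithLp.toLp 2 (fun i => B i j) : EuclideanSpace 𝕜 (Fin n)))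
        = B.conjTranspose * B := by
      ext i j
      simp [Matrix.gram_apply, Matrix.mul_apply, PiLp.inner_apply, mul_comm]
    refine ⟨_, fun i => ?_, hg⟩
    have h2 := h1 i
    rw [← hg, Matrix.gram_apply, inner_self_eq_norm_sq_to_K] at h2
    have h3 : ‖(WithLp.toLp 2 (fun k => B k i) : EuclideanSpace 𝕜 (Fin n))‖ ^ 2 = 1 := by
      exact_mod_cast h2
    exact (pow_eq_one_iff_of_nonneg (norm_nonneg _) two_ne_zero).mp h3
  · rintro ⟨x, hx, rfl⟩
    refine ⟨Matrix.posSemidef_gram 𝕜 x, fun i => ?_⟩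
    simp [Matrix.gram_apply, inner_self_eq_norm_sq_to_K, hx i]

theorem isCompact_correlation (n : ℕ) : IsCompact (correlation 𝕜 n) := by
  rw [correlation_eq_gram]
  refine (isCompact_unitTuples 𝕜 n n).image ?_
  refine continuous_matrix fun i j => ?_
  simp only [Matrix.gram_apply]
  fun_prop

variable {𝕜}

theorem isCompact_quadValues {n : ℕ} (A : Matrix (Fin n) (Fin n) 𝕜) :
    IsCompact (quadValues A) := by
  refine (isCompact_unimodular 𝕜 n).image (RCLike.continuous_re.comp ?_)
  exact continuous_star.dotProduct (continuous_const.matrix_mulVec continuous_id)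

theorem isCompact_traceValues {n : ℕ} (A : Matrix (Fin n) (Fin n) 𝕜) :
    IsCompact (traceValues A) := by
  refine (isCompact_correlation 𝕜 n).image (RCLike.continuous_re.comp ?_)
  exact (continuous_const.matrix_mul continuous_id).matrix_trace

theorem isGreatest_quadValues {n : ℕ} (A : Matrix (Fin n) (Fin n) 𝕜) :
    IsGreatest (quadValues A) (sSup (quadValues A)) :=
  (isCompact_quadValues A).isGreatest_sSup ((unimodular_nonempty 𝕜 n).image _)

theorem isLeast_quadValues {n : ℕ} (A : Matrix (Fin n) (Fin n) 𝕜) :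
    IsLeast (quadValues A) (sInf (quadValues A)) :=
  (isCompact_quadValues A).isLeast_sInf ((unimodular_nonempty 𝕜 n).image _)

theorem isGreatest_traceValues {n : ℕ} (A : Matrix (Fin n) (Fin n) 𝕜) :
    IsGreatest (traceValues A) (sSup (traceValues A)) :=
  (isCompact_traceValues A).isGreatest_sSup ((correlation_nonempty 𝕜 n).image _)

theorem isLeast_traceValues {n : ℕ} (A : Matrix (Fin n) (Fin n) 𝕜) :
    IsLeast (traceValues A) (sInf (traceValues A)) :=
  (isCompact_traceValues A).isLeast_sInf ((correlation_nonempty 𝕜 n).image _)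

theorem isGreatest_gammaValues {d n : ℕ} (h : n ≤ d) (A : Matrix (Fin n) (Fin n) 𝕜) :
    IsGreatest (gammaValues d A) (gammaSeminorm d A) := by
  refine IsCompact.isGreatest_sSup ((isCompact_unitTuples 𝕜 d n).image ?_)
    ((unitTuples_nonempty 𝕜 h).image _)
  fun_prop

theorem isGreatest_thetaValues {n : ℕ} (A : Matrix (Fin n) (Fin n) 𝕜) :
    IsGreatest (thetaValues A) (thetaSeminorm A) := by
  refine IsCompact.isGreatest_sSup ((isCompact_unimodular 𝕜 n).image ?_)
    ((unimodular_nonempty 𝕜 n).image _)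
  fun_prop

end SymGrothendieck

end

open scoped ComplexOrder

noncomputable section

namespace SymGrothendieck

variable {𝕜 : Type*} [RCLike 𝕜] {n : ℕ}

/-! Matrices `x x*` with `x` unimodular are correlation matrices, so str ≤ spr. For the converse, a
diagonal shift of trace `-c` translates every `x* A x` and every `tr (A X)` by `-c`. With `c` the
midpoint of the range of `x* A x`, the θ-seminorm of the shifted matrix is at most str/2, and
Grothendieck's inequality confines all `tr (A X)` to an interval of length `K` str
(`spread_le_mul_stretch`).

What remains is that some finite constant exists. For zero diagonal, replace a family of vectors by
all its signed sums, which preserves the averaged form and second moments and controls fourth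
moments. Truncated sums lie in a polydisc, where θ bounds the form; the tails have small second
moment, so any admissible bound `C` improves to `60 * θ + C / 2` (`IsGammaBound.improve`). The best
bound is thus at most `120 * θ`. Restoring the diagonal gives 241. -/

/-- The real part of the sesquilinear form `v* A w`. -/
def reForm (A : Matrix (Fin n) (Fin n) 𝕜) (v w : Fin n → 𝕜) : ℝ :=
  RCLike.re (star v ⬝ᵥ A.mulVec w)

theorem reForm_add_left (A : Matrix (Fin n) (Fin n) 𝕜) (u v w : Fin n → 𝕜) :
    reForm A (u + v) w = reForm A u w + reForm A v w := by
  simp [reForm, add_dotProduct]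

theorem reForm_add_right (A : Matrix (Fin n) (Fin n) 𝕜) (u v w : Fin n → 𝕜) :
    reForm A u (v + w) = reForm A u v + reForm A u w := by
  simp [reForm, Matrix.mulVec_add, dotProduct_add]

theorem reForm_smul_left (A : Matrix (Fin n) (Fin n) 𝕜) (t : ℝ) (v w : Fin n → 𝕜) :
    reForm A (t • v) w = t * reForm A v w := by
  have h : star (t • v) = (t : 𝕜) • star v := by
    ext i; simp [RCLike.real_smul_eq_coe_mul]
  rw [reForm, h, smul_dotProduct, smul_eq_mul, RCLike.re_ofReal_mul, reForm]

theorem reForm_smul_right (A : Matrix (Fin n) (Fin n) 𝕜) (t : ℝ) (v w : Fin n → 𝕜) :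
    reForm A v (t • w) = t * reForm A v w := by
  have h : t • w = (t : 𝕜) • w := by
    ext i; simp [RCLike.real_smul_eq_coe_mul]
  rw [reForm, h, Matrix.mulVec_smul, dotProduct_smul, smul_eq_mul, RCLike.re_ofReal_mul, reForm]

theorem star_dotProduct_mulVec {A : Matrix (Fin n) (Fin n) 𝕜} (hA : A.IsHermitian)
    (v w : Fin n → 𝕜) : star (star v ⬝ᵥ A.mulVec w) = star w ⬝ᵥ A.mulVec v := by
  rw [Matrix.star_dotProduct, star_star, Matrix.star_mulVec, hA.eq, Matrix.dotProduct_mulVec]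

theorem reForm_comm {A : Matrix (Fin n) (Fin n) 𝕜} (hA : A.IsHermitian) (v w : Fin n → 𝕜) :
    reForm A v w = reForm A w v := by
  rw [reForm, reForm, ← star_dotProduct_mulVec hA v w, RCLike.star_def, RCLike.conj_re]

/-- The quadratic form `v* A v` as a real number. -/
def quadForm (A : Matrix (Fin n) (Fin n) 𝕜) (v : Fin n → 𝕜) : ℝ := reForm A v v

theorem quadForm_add_smul {A : Matrix (Fin n) (Fin n) 𝕜} (hA : A.IsHermitian) (v w : Fin n → 𝕜)
    (t : ℝ) :
    quadForm A (v + t • w) = quadForm A v + 2 * t * reForm A v w + t ^ 2 * quadForm A w := by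
  simp only [quadForm, reForm_add_left, reForm_add_right, reForm_smul_left, reForm_smul_right,
    reForm_comm hA w v]
  ring

theorem quadForm_smul (A : Matrix (Fin n) (Fin n) 𝕜) (t : ℝ) (v : Fin n → 𝕜) :
    quadForm A (t • v) = t ^ 2 * quadForm A v := by
  simp only [quadForm, reForm_smul_left, reForm_smul_right]; ring

theorem quadForm_single {A : Matrix (Fin n) (Fin n) 𝕜} (a : Fin n) (h : A a a = 0) (u : 𝕜) :
    quadForm A (Pi.single a u) = 0 := by
  simp [quadForm, reForm, h]

theorem quadForm_zero (A : Matrix (Fin n) (Fin n) 𝕜) : quadForm A 0 = 0 := by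
  simp [quadForm, reForm]

theorem sum_sum_eq_dotProduct (A : Matrix (Fin n) (Fin n) 𝕜) (v : Fin n → 𝕜) :
    ∑ i, ∑ j, A i j * star (v i) * v j = star v ⬝ᵥ A.mulVec v := by
  simp only [dotProduct, Matrix.mulVec, Finset.mul_sum, Pi.star_apply]
  exact Finset.sum_congr rfl fun i _ => Finset.sum_congr rfl fun j _ => by ring

theorem dotProduct_mulVec_eq_quadForm {A : Matrix (Fin n) (Fin n) 𝕜} (hA : A.IsHermitian)
    (v : Fin n → 𝕜) : star v ⬝ᵥ A.mulVec v = (quadForm A v : 𝕜) :=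
  (RCLike.conj_eq_iff_re.mp (star_dotProduct_mulVec hA v v)).symm

/-! ### From the torus to the polydisc. -/

theorem exists_smul_of_norm_le_one {z : 𝕜} (hz : ‖z‖ ≤ 1) :
    ∃ (u : 𝕜) (t : ℝ), ‖u‖ = 1 ∧ 0 ≤ t ∧ t ≤ 1 ∧ z = t • u := by
  rcases eq_or_ne z 0 with rfl | h
  · exact ⟨1, 0, by simp⟩
  · refine ⟨‖z‖⁻¹ • z, ‖z‖, ?_, norm_nonneg _, hz, ?_⟩
    · simp [norm_smul, h]
    · rw [smul_smul, mul_inv_cancel₀ (norm_ne_zero_iff.mpr h), one_smul]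

/-- A Hermitian form without diagonal terms is affine in each variable, so its bounds on the torus
hold on the polydisc. -/
theorem abs_quadForm_add_le_of_unimodular {A : Matrix (Fin n) (Fin n) 𝕜} (hA : A.IsHermitian)
    (h0 : ∀ i, A i i = 0) {t θ : ℝ} (hθ : ∀ x ∈ unimodular 𝕜 n, |quadForm A x + t| ≤ θ)
    (w : Fin n → 𝕜) (hw : ∀ i, ‖w i‖ ≤ 1) : |quadForm A w + t| ≤ θ := by
  suffices H : ∀ (s : Finset (Fin n)) (w : Fin n → 𝕜), (∀ i, ‖w i‖ ≤ 1) →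
      (∀ i ∉ s, ‖w i‖ = 1) → |quadForm A w + t| ≤ θ from H Finset.univ w hw (by simp)
  intro s
  induction s using Finset.induction_on with
  | empty => exact fun w _ h => hθ w fun i => h i (by simp)
  | insert a s _ ih =>
    intro w hw hs
    obtain ⟨u, r, hu, hr0, hr1, hwa⟩ := exists_smul_of_norm_le_one (hw a)
    have key : ∀ y : 𝕜, ‖y‖ = 1 → |quadForm A (Function.update w a y) + t| ≤ θ := by
      intro y hy
      refine ih _ (fun i => ?_) fun i hi => ?_
      · rcases eq_or_ne i a with rfl | h
        · simp [hy]
        · simp [h, hw i]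
      · rcases eq_or_ne i a with rfl | h
        · simp [hy]
        · simpa [h] using hs i (by simp [h, hi])
    have hupd : ∀ r : ℝ, Function.update w a (r • u) =
        Function.update w a 0 + r • (Pi.single a u : Fin n → 𝕜) := by
      intro r; ext i
      rcases eq_or_ne i a with rfl | h
      · simp
      · simp [h]
    have h1 := key u hu
    have h2 := key (-u) (by simpa using hu)
    have e0 := hupd r
    have e1 := hupd 1
    have e2 := hupd (-1)
    rw [← hwa, Function.update_eq_self] at e0
    rw [one_smul] at e1
    rw [neg_one_smul] at e2
    -- With no quadratic term the form is affine in the real parameter, and `r` lies between the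
    -- endpoints `-1` and `1`.
    rw [e1, quadForm_add_smul hA, quadForm_single a (h0 a), abs_le] at h1
    rw [e2, quadForm_add_smul hA, quadForm_single a (h0 a), abs_le] at h2
    rw [e0, quadForm_add_smul hA, quadForm_single a (h0 a), abs_le]
    constructor <;> nlinarith [h1.1, h1.2, h2.1, h2.2]

theorem abs_quadForm_le_of_unimodular {A : Matrix (Fin n) (Fin n) 𝕜} (hA : A.IsHermitian)
    (h0 : ∀ i, A i i = 0) {θ : ℝ} (hθ : ∀ x ∈ unimodular 𝕜 n, |quadForm A x| ≤ θ)
    {R : ℝ} (hR : 0 < R) (w : Fin n → 𝕜) (hw : ∀ i, ‖w i‖ ^ 2 ≤ R) :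
    |quadForm A w| ≤ R * θ := by
  have h := abs_quadForm_add_le_of_unimodular hA h0 (t := 0) (θ := θ) (by simpa using hθ)
    ((√R)⁻¹ • w) fun i => by
      have hs : 0 < √R := Real.sqrt_pos.mpr hR
      rw [Pi.smul_apply, norm_smul, norm_inv, Real.norm_of_nonneg hs.le, inv_mul_le_iff₀ hs,
        mul_one]
      exact Real.le_sqrt_of_sq_le (hw i)
  rw [add_zero, quadForm_smul, inv_pow, Real.sq_sqrt hR.le, abs_mul, abs_of_pos (inv_pos.mpr hR),
    inv_mul_le_iff₀ hR] at h
  exact h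

/-! ### Signed sums and their moments. -/

/-- Squaring the expansions leaves a cross term `8 * p ^ 2`, handled by Cauchy–Schwarz. The
coefficient 6 is what lets the fourth-moment constant 3 survive induction: `3 S² + 6 S b² + b⁴ ≤ 3
(S + b²)²`. -/
theorem norm_add_pow_four_add_norm_sub_pow_four_le (a b : 𝕜) :
    ‖a + b‖ ^ 4 + ‖a - b‖ ^ 4 ≤ 2 * (‖a‖ ^ 4 + 6 * ‖a‖ ^ 2 * ‖b‖ ^ 2 + ‖b‖ ^ 4) := by
  have h1 := norm_add_sq (𝕜 := 𝕜) a b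
  have h2 := norm_sub_sq (𝕜 := 𝕜) a b
  have h3 := abs_le.mp ((RCLike.abs_re_le_norm _).trans (norm_inner_le_norm (𝕜 := 𝕜) a b))
  set p := RCLike.re (inner 𝕜 a b)
  have h4 : p ^ 2 ≤ (‖a‖ * ‖b‖) ^ 2 := sq_le_sq' h3.1 h3.2
  have e : ∀ x : ℝ, x ^ 4 = (x ^ 2) ^ 2 := fun x => by ring
  rw [e ‖a + b‖, e ‖a - b‖, h1, h2]
  nlinarith

/-- The family of all signed sums of the vectors `x k`, `k ∈ s`, with its second and fourth
moments. -/
theorem exists_signed_sums {A : Matrix (Fin n) (Fin n) 𝕜} (hA : A.IsHermitian) {ι : Type}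
    (x : ι → Fin n → 𝕜) (s : Finset ι) :
    ∃ (Ω : Type) (_ : Fintype Ω) (_ : Nonempty Ω) (f : Ω → Fin n → 𝕜),
      (∑ ω, quadForm A (f ω) = Fintype.card Ω * ∑ k ∈ s, quadForm A (x k)) ∧
      (∀ i, ∑ ω, ‖f ω i‖ ^ 2 = Fintype.card Ω * ∑ k ∈ s, ‖x k i‖ ^ 2) ∧
      (∀ i, ∑ ω, ‖f ω i‖ ^ 4 ≤ 3 * Fintype.card Ω * (∑ k ∈ s, ‖x k i‖ ^ 2) ^ 2) := by
  classical
  induction s using Finset.induction_on with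
  | empty => exact ⟨Unit, inferInstance, inferInstance, 0, by simp [quadForm_zero]⟩
  | insert a s ha ih =>
    obtain ⟨Ω, _, _, f, hq, h2, h4⟩ := ih
    refine ⟨Ω × Bool, inferInstance, inferInstance,
      fun p => if p.2 then f p.1 + x a else f p.1 - x a, ?_, fun i => ?_, fun i => ?_⟩
    · have h : ∀ ω, quadForm A (f ω + x a) + quadForm A (f ω - x a) =
          2 * quadForm A (f ω) + 2 * quadForm A (x a) := by
        intro ω
        have e1 := quadForm_add_smul hA (f ω) (x a) 1
        have e2 := quadForm_add_smul hA (f ω) (x a) (-1)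
        rw [one_smul] at e1
        rw [neg_one_smul, ← sub_eq_add_neg] at e2
        rw [e1, e2]; ring
      simp only [Fintype.sum_prod_type, Fintype.sum_bool, if_true, Bool.false_eq_true, if_false, h,
        Finset.sum_add_distrib, ← Finset.mul_sum, hq, Finset.sum_insert ha, Fintype.card_prod,
        Fintype.card_bool, Finset.sum_const, Finset.card_univ, nsmul_eq_mul]
      push_cast; ring
    · have h : ∀ ω, ‖f ω i + x a i‖ ^ 2 + ‖f ω i - x a i‖ ^ 2 =
          2 * ‖f ω i‖ ^ 2 + 2 * ‖x a i‖ ^ 2 := by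
        intro ω
        rw [norm_add_sq (𝕜 := 𝕜), norm_sub_sq (𝕜 := 𝕜)]; ring
      simp only [Fintype.sum_prod_type, Fintype.sum_bool, if_true, Bool.false_eq_true, if_false,
        Pi.add_apply, Pi.sub_apply, h, Finset.sum_add_distrib, ← Finset.mul_sum, h2,
        Finset.sum_insert ha, Fintype.card_prod,
        Fintype.card_bool, Finset.sum_const, Finset.card_univ, nsmul_eq_mul]
      push_cast; ring
    · simp only [Fintype.sum_prod_type, Fintype.sum_bool, if_true, Bool.false_eq_true, if_false,
        Pi.add_apply, Pi.sub_apply, Finset.sum_insert ha, Fintype.card_prod, Fintype.card_bool]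
      refine (Finset.sum_le_sum fun ω _ =>
        norm_add_pow_four_add_norm_sub_pow_four_le (f ω i) (x a i)).trans ?_
      rw [← Finset.mul_sum, Finset.sum_add_distrib, Finset.sum_add_distrib, ← Finset.sum_mul,
        ← Finset.mul_sum, h2 i, Finset.sum_const, Finset.card_univ, nsmul_eq_mul]
      have hN : (0 : ℝ) ≤ Fintype.card Ω * ‖x a i‖ ^ 4 := by positivity
      push_cast
      nlinarith [h4 i]

/-! ### Truncation and the self-improving bound. -/

/-- `C` bounds the form `A` on all finite families of vectors, in terms of the largest coordinate
second moment. -/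
def IsGammaBound (A : Matrix (Fin n) (Fin n) 𝕜) (C : ℝ) : Prop :=
  ∀ (ι : Type) [Fintype ι] (x : ι → Fin n → 𝕜) (c : ℝ), 0 < c → (∀ i, ∑ k, ‖x k i‖ ^ 2 ≤ c) →
    |∑ k, quadForm A (x k)| ≤ C * c

theorem abs_quadForm_le (A : Matrix (Fin n) (Fin n) 𝕜) (v : Fin n → 𝕜) :
    |quadForm A v| ≤ ∑ i, ∑ j, ‖A i j‖ * ((‖v i‖ ^ 2 + ‖v j‖ ^ 2) / 2) := by
  rw [quadForm, reForm, ← sum_sum_eq_dotProduct]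
  refine (RCLike.abs_re_le_norm _).trans ((norm_sum_le _ _).trans ?_)
  refine Finset.sum_le_sum fun i _ => (norm_sum_le _ _).trans (Finset.sum_le_sum fun j _ => ?_)
  rw [norm_mul, norm_mul, norm_star, mul_assoc]
  gcongr
  nlinarith [sq_nonneg (‖v i‖ - ‖v j‖)]

/-- A crude bound, needed only so that the set of bounds is nonempty. -/
theorem isGammaBound_sum_norm (A : Matrix (Fin n) (Fin n) 𝕜) :
    IsGammaBound A (∑ i, ∑ j, ‖A i j‖) := by
  intro ι _ x c _ hx
  refine (Finset.abs_sum_le_sum_abs _ _).trans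
    ((Finset.sum_le_sum fun k _ => abs_quadForm_le A (x k)).trans ?_)
  rw [Finset.sum_comm, Finset.sum_mul]
  refine Finset.sum_le_sum fun i _ => ?_
  rw [Finset.sum_comm, Finset.sum_mul]
  refine Finset.sum_le_sum fun j _ => ?_
  rw [← Finset.mul_sum, ← Finset.sum_div, Finset.sum_add_distrib]
  gcongr
  linarith [hx i, hx j]

/-- Truncating the signed sums of a family improves a bound. -/
theorem IsGammaBound.improve {A : Matrix (Fin n) (Fin n) 𝕜} (hA : A.IsHermitian)
    (h0 : ∀ i, A i i = 0) {θ : ℝ} (hθ : ∀ x ∈ unimodular 𝕜 n, |quadForm A x| ≤ θ)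
    {C : ℝ} (hC : IsGammaBound A C) : IsGammaBound A (60 * θ + C / 2) := by
  classical
  intro ι _ x c hc hx
  obtain ⟨Ω, _, _, f, hq, h2, h4⟩ := exists_signed_sums hA x Finset.univ
  set N : ℝ := (Fintype.card Ω : ℝ) with hN
  have hN0 : 0 < N := by
    rw [hN]; exact_mod_cast Fintype.card_pos
  let g : Ω → Fin n → 𝕜 := fun ω i => if ‖f ω i‖ ^ 2 ≤ 60 * c then f ω i else 0
  have hg : ∀ ω, |quadForm A (g ω)| ≤ 60 * c * θ := fun ω => by
    refine abs_quadForm_le_of_unimodular hA h0 hθ (by positivity) _ fun i => ?_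
    by_cases h : ‖f ω i‖ ^ 2 ≤ 60 * c
    · simp [g, h]
    · simp [g, h, hc.le]
  have hG : |∑ ω, quadForm A (g ω)| ≤ N * (60 * c * θ) := by
    refine (Finset.abs_sum_le_sum_abs _ _).trans ((Finset.sum_le_sum fun ω _ => hg ω).trans ?_)
    simp [hN]
  -- Polarization of `Q(f) - Q(g) = Re (f + g)* A (f - g)`. The weight 9 makes the divisor 36 while
  -- the small tail `f - g` keeps the second moments at most `9 * (N * c)`; the two terms then cost
  -- `2 * 9 / 36 = 1 / 2` of `C`.
  have hdiff : ∀ ω, quadForm A (f ω) = quadForm A (g ω) +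
      (quadForm A ((f ω + g ω) + (9 : ℝ) • (f ω - g ω)) -
        quadForm A ((f ω + g ω) + (-9 : ℝ) • (f ω - g ω))) / 36 := by
    intro ω
    rw [quadForm_add_smul hA, quadForm_add_smul hA]
    have e : reForm A (f ω + g ω) (f ω - g ω) = quadForm A (f ω) - quadForm A (g ω) := by
      rw [sub_eq_add_neg, ← neg_one_smul ℝ (g ω)]
      simp only [quadForm, reForm_add_left, reForm_add_right, reForm_smul_right,
        reForm_comm hA (g ω) (f ω)]
      ring
    rw [e]; ring
  have hbound : ∀ t : ℝ, t = 9 ∨ t = -9 →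
      |∑ ω, quadForm A ((f ω + g ω) + t • (f ω - g ω))| ≤ C * (9 * (N * c)) := by
    intro t ht
    -- The bound is reused on the larger index type `Ω`, hence the quantification over all `ι` in
    -- `IsGammaBound`.
    refine hC Ω _ _ (by positivity) fun i => ?_
    have hpt : ∀ ω, ‖((f ω + g ω) + t • (f ω - g ω)) i‖ ^ 2 ≤
        4 * ‖f ω i‖ ^ 2 + 100 / (60 * c) * ‖f ω i‖ ^ 4 := by
      intro ω
      by_cases h : ‖f ω i‖ ^ 2 ≤ 60 * c
      · have e : ((f ω + g ω) + t • (f ω - g ω)) i = (2 : ℝ) • f ω i := by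
          simp [g, h, two_smul]
        rw [e, norm_smul, mul_pow]
        have : 0 ≤ 100 / (60 * c) * ‖f ω i‖ ^ 4 := by positivity
        norm_num
        linarith
      · have e : ((f ω + g ω) + t • (f ω - g ω)) i = (1 + t) • f ω i := by
          simp [g, h, add_smul]
        rw [e, norm_smul, mul_pow, Real.norm_eq_abs, sq_abs]
        have ht2 : (1 + t) ^ 2 ≤ 100 := by rcases ht with rfl | rfl <;> norm_num
        have h3 : ‖f ω i‖ ^ 2 ≤ 1 / (60 * c) * ‖f ω i‖ ^ 4 := by
          rw [div_mul_eq_mul_div, one_mul, le_div_iff₀ (by positivity)]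
          nlinarith [sq_nonneg ‖f ω i‖]
        calc (1 + t) ^ 2 * ‖f ω i‖ ^ 2 ≤ 100 * (1 / (60 * c) * ‖f ω i‖ ^ 4) := by gcongr
          _ = 100 / (60 * c) * ‖f ω i‖ ^ 4 := by ring
          _ ≤ _ := by
            have : 0 ≤ 4 * ‖f ω i‖ ^ 2 := by positivity
            linarith
    calc ∑ ω, ‖((f ω + g ω) + t • (f ω - g ω)) i‖ ^ 2
        ≤ ∑ ω, (4 * ‖f ω i‖ ^ 2 + 100 / (60 * c) * ‖f ω i‖ ^ 4) :=
          Finset.sum_le_sum fun ω _ => hpt ω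
      _ = 4 * ∑ ω, ‖f ω i‖ ^ 2 + 100 / (60 * c) * ∑ ω, ‖f ω i‖ ^ 4 := by
          rw [Finset.sum_add_distrib, Finset.mul_sum, Finset.mul_sum]
      _ ≤ 4 * (N * c) + 100 / (60 * c) * (3 * N * c ^ 2) := by
          have hs : 0 ≤ ∑ k, ‖x k i‖ ^ 2 := Finset.sum_nonneg fun k _ => by positivity
          gcongr
          · rw [h2 i]; gcongr; exact hx i
          · refine (h4 i).trans ?_
            gcongr; exact hx i
      -- The level 60 gives `4 + 300 / 60 = 9`.
      _ = 9 * (N * c) := by field_simp; norm_num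
  have hsum : N * ∑ k, quadForm A (x k) = ∑ ω, quadForm A (g ω) +
      (∑ ω, quadForm A ((f ω + g ω) + (9 : ℝ) • (f ω - g ω)) -
        ∑ ω, quadForm A ((f ω + g ω) + (-9 : ℝ) • (f ω - g ω))) / 36 := by
    rw [← hq, ← Finset.sum_sub_distrib, Finset.sum_div, ← Finset.sum_add_distrib]
    exact Finset.sum_congr rfl fun ω _ => hdiff ω
  have hb1 := abs_le.mp (hbound 9 (Or.inl rfl))
  have hb2 := abs_le.mp (hbound (-9) (Or.inr rfl))
  have hG' := abs_le.mp hG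
  rw [abs_le]
  constructor
  · refine le_of_mul_le_mul_left ?_ hN0
    rw [hsum]; linarith [hb1.1, hb2.2, hG'.1]
  · refine le_of_mul_le_mul_left ?_ hN0
    rw [hsum]; linarith [hb1.2, hb2.1, hG'.2]

/-- Grothendieck's inequality for Hermitian forms without diagonal terms. -/
theorem abs_sum_quadForm_le {A : Matrix (Fin n) (Fin n) 𝕜} (hA : A.IsHermitian)
    (h0 : ∀ i, A i i = 0) {θ : ℝ} (hθ : ∀ x ∈ unimodular 𝕜 n, |quadForm A x| ≤ θ)
    {ι : Type} [Fintype ι] (x : ι → Fin n → 𝕜) (hx : ∀ i, ∑ k, ‖x k i‖ ^ 2 ≤ 1) :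
    |∑ k, quadForm A (x k)| ≤ 120 * θ := by
  set S := {C | IsGammaBound A C}
  have hne : S.Nonempty := ⟨_, isGammaBound_sum_norm A⟩
  have hval : ∀ C ∈ S, |∑ k, quadForm A (x k)| ≤ C := fun C hC => by
    simpa using hC ι x 1 one_pos hx
  have hbdd : BddBelow S := ⟨_, hval⟩
  have h1 : |∑ k, quadForm A (x k)| ≤ sInf S := le_csInf hne hval
  -- Since `S` is stable under `C ↦ 60 * θ + C / 2`, its infimum is at most the fixed point `120 *
  -- θ`.
  have h2 : 2 * (sInf S - 60 * θ) ≤ sInf S := le_csInf hne fun C hC => by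
    have := csInf_le hbdd (IsGammaBound.improve hA h0 hθ hC)
    linarith
  linarith

/-! ### Existence of the least constant. -/

/-- Reading the vectors coordinatewise gives a family indexed by `Fin d`; unit length becomes unit
second moment. -/
theorem sum_sum_inner_eq {A : Matrix (Fin n) (Fin n) 𝕜} (hA : A.IsHermitian) {d : ℕ}
    (x : Fin n → EuclideanSpace 𝕜 (Fin d)) :
    ∑ i, ∑ j, A i j * inner 𝕜 (x i) (x j) = ((∑ k, quadForm A fun i => x i k : ℝ) : 𝕜) := by
  push_cast
  simp only [← dotProduct_mulVec_eq_quadForm hA, ← sum_sum_eq_dotProduct]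
  rw [Finset.sum_comm]
  simp only [PiLp.inner_apply, Finset.mul_sum]
  rw [Finset.sum_comm]
  conv_rhs => rw [Finset.sum_comm]
  refine Finset.sum_congr rfl fun i _ => ?_
  conv_rhs => rw [Finset.sum_comm]
  refine Finset.sum_congr rfl fun j _ => Finset.sum_congr rfl fun k _ => ?_
  simp [mul_comm, mul_left_comm]

theorem quadForm_add_diagonal (A : Matrix (Fin n) (Fin n) 𝕜) (D : Fin n → ℝ) (v : Fin n → 𝕜) :
    quadForm (A + Matrix.diagonal fun i => (D i : 𝕜)) v =
      quadForm A v + ∑ i, D i * ‖v i‖ ^ 2 := by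
  have h : star v ⬝ᵥ (Matrix.diagonal fun i => (D i : 𝕜)).mulVec v =
      ((∑ i, D i * ‖v i‖ ^ 2 : ℝ) : 𝕜) := by
    push_cast
    refine Finset.sum_congr rfl fun i _ => ?_
    rw [Matrix.mulVec_diagonal, Pi.star_apply, RCLike.star_def, mul_left_comm, RCLike.conj_mul]
  simp only [quadForm, reForm, Matrix.add_mulVec, dotProduct_add, map_add, h, RCLike.ofReal_re]

theorem isHermitian_diagonal_ofReal (D : Fin n → ℝ) :
    (Matrix.diagonal fun i => (D i : 𝕜)).IsHermitian :=
  Matrix.isHermitian_diagonal_of_self_adjoint _ (by ext i; simp)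

theorem quadForm_abs_mem_thetaValues {A : Matrix (Fin n) (Fin n) 𝕜} (hA : A.IsHermitian)
    {x : Fin n → 𝕜} (hx : x ∈ unimodular 𝕜 n) : |quadForm A x| ∈ thetaValues A := by
  refine ⟨x, hx, ?_⟩
  simp only [sum_sum_eq_dotProduct, dotProduct_mulVec_eq_quadForm hA, RCLike.norm_ofReal]

theorem thetaSeminorm_nonneg (A : Matrix (Fin n) (Fin n) 𝕜) : 0 ≤ thetaSeminorm A := by
  obtain ⟨x, -, h⟩ := (isGreatest_thetaValues A).1
  rw [← h]; exact norm_nonneg _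

/-- On unit vectors the diagonal contributes exactly the trace `t`. Removing it costs at most a
factor 2 in θ, whence `241 = 120 * 2 + 1`. -/
theorem mem_grothendieckConstants : (241 : ℝ) ∈ grothendieckConstants 𝕜 := by
  intro n d hnd A hA
  obtain ⟨x, hx, hxA⟩ := (isGreatest_gammaValues hnd A).1
  rw [← hxA]
  simp only [sum_sum_inner_eq hA, RCLike.norm_ofReal]
  set θ := thetaSeminorm A
  have hθ : ∀ y ∈ unimodular 𝕜 n, |quadForm A y| ≤ θ := fun y hy =>
    (isGreatest_thetaValues A).2 (quadForm_abs_mem_thetaValues hA hy)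
  let D : Fin n → ℝ := fun i => RCLike.re (A i i)
  have hD : ∀ i, (D i : 𝕜) = A i i := fun i => hA.coe_re_apply_self i
  set B := A + Matrix.diagonal fun i => ((-D i : ℝ) : 𝕜)
  have hB : B.IsHermitian := hA.add (isHermitian_diagonal_ofReal _)
  have hB0 : ∀ i, B i i = 0 := fun i => by simp [B, hD]
  have hAB : ∀ v, quadForm A v = quadForm B v + ∑ i, D i * ‖v i‖ ^ 2 := fun v => by
    rw [quadForm_add_diagonal]; simp
  set t := ∑ i, D i
  have hθB : ∀ y ∈ unimodular 𝕜 n, |quadForm B y + t| ≤ θ := fun y hy => by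
    have h := hθ y hy
    rw [hAB] at h
    simpa [show ∀ i, ‖y i‖ = 1 from hy] using h
  -- At the centre of the polydisc only the trace remains.
  have ht : |t| ≤ θ := by
    simpa [quadForm_zero] using
      abs_quadForm_add_le_of_unimodular hB hB0 hθB 0 (by simp)
  have hθ2 : ∀ y ∈ unimodular 𝕜 n, |quadForm B y| ≤ 2 * θ := fun y hy => by
    have h1 := abs_le.mp (hθB y hy)
    have h2 := abs_le.mp ht
    exact abs_le.mpr ⟨by linarith [h1.1, h2.2], by linarith [h1.2, h2.1]⟩
  have hnorm : ∀ i, ∑ k, ‖x i k‖ ^ 2 = 1 := fun i => by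
    rw [← EuclideanSpace.norm_sq_eq, hx i, one_pow]
  have hG := abs_sum_quadForm_le hB hB0 hθ2 (fun k i => x i k) fun i => (hnorm i).le
  have hsum : ∑ k, quadForm A (fun i => x i k) = ∑ k, quadForm B (fun i => x i k) + t := by
    simp only [hAB, Finset.sum_add_distrib]
    rw [Finset.sum_comm]
    simp [← Finset.mul_sum, hnorm, t]
  rw [hsum]
  refine (abs_add_le _ _).trans ?_
  linarith

theorem one_le_of_mem_grothendieckConstants {K : ℝ} (hK : K ∈ grothendieckConstants 𝕜) :
    1 ≤ K := by
  have h := hK 1 1 le_rfl 1 Matrix.isHermitian_one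
  have h1 : 1 ≤ gammaSeminorm 1 (1 : Matrix (Fin 1) (Fin 1) 𝕜) := by
    obtain ⟨x, hx⟩ := unitTuples_nonempty 𝕜 (le_refl 1)
    refine (isGreatest_gammaValues le_rfl _).2 ⟨x, hx, ?_⟩
    simp [inner_self_eq_norm_sq_to_K, hx 0]
  have h2 : thetaSeminorm (1 : Matrix (Fin 1) (Fin 1) 𝕜) = 1 := by
    obtain ⟨x, hx, h⟩ := (isGreatest_thetaValues (1 : Matrix (Fin 1) (Fin 1) 𝕜)).1
    rw [← h]
    simp [hx 0]
  rw [h2, mul_one] at h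
  exact h1.trans h

/-- Each instance of the inequality is a closed condition on `K`, so the infimum is attained. -/
theorem isLeast_Kγ : IsLeast (grothendieckConstants 𝕜) (Kγ 𝕜) := by
  have hbdd : BddBelow (grothendieckConstants 𝕜) :=
    ⟨1, fun _ => one_le_of_mem_grothendieckConstants⟩
  refine ⟨IsClosed.csInf_mem ?_ ⟨_, mem_grothendieckConstants⟩ hbdd, fun K hK => csInf_le hbdd hK⟩
  simp only [grothendieckConstants, Set.ofPred_forall]
  exact isClosed_iInter fun n => isClosed_iInter fun d => isClosed_iInter fun _ =>
    isClosed_iInter fun A => isClosed_iInter fun _ =>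
      isClosed_le continuous_const (continuous_id.mul continuous_const)

/-! ### Comparison of stretch and spread. -/

theorem quadValues_subset_traceValues (A : Matrix (Fin n) (Fin n) 𝕜) :
    quadValues A ⊆ traceValues A := by
  rintro _ ⟨x, hx, rfl⟩
  refine ⟨Matrix.vecMulVec x (star x), ⟨Matrix.posSemidef_vecMulVec_self_star x, fun i => ?_⟩, ?_⟩
  · simp [Matrix.vecMulVec_apply, RCLike.mul_conj, show ‖x i‖ = 1 from hx i]
  · simp [Matrix.mul_vecMulVec, Matrix.trace_vecMulVec, dotProduct_comm]

theorem stretch_le_spread (A : Matrix (Fin n) (Fin n) 𝕜) : stretch A ≤ spread A :=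
  sub_le_sub
    ((isGreatest_traceValues A).2 (quadValues_subset_traceValues A (isGreatest_quadValues A).1))
    ((isLeast_traceValues A).2 (quadValues_subset_traceValues A (isLeast_quadValues A).1))

theorem re_trace_le_gammaSeminorm (A : Matrix (Fin n) (Fin n) 𝕜)
    {X : Matrix (Fin n) (Fin n) 𝕜} (hX : X ∈ correlation 𝕜 n) :
    |RCLike.re (A * X).trace| ≤ gammaSeminorm n A := by
  -- The trace pairs `A i j` with `X j i`, so the transpose is the matrix to write as a Gram matrix.
  have hXt : X.transpose ∈ correlation 𝕜 n := ⟨hX.1.transpose, hX.2⟩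
  rw [correlation_eq_gram] at hXt
  obtain ⟨x, hx, hxX⟩ := hXt
  refine (RCLike.abs_re_le_norm _).trans ((isGreatest_gammaValues le_rfl A).2 ⟨x, hx, ?_⟩)
  have h : ∀ i j, inner 𝕜 (x i) (x j) = X j i := fun i j => congrFun (congrFun hxX i) j
  simp only [h, Matrix.trace, Matrix.diag_apply, Matrix.mul_apply]

theorem spread_le_mul_stretch {K : ℝ} (hK : K ∈ grothendieckConstants 𝕜)
    {A : Matrix (Fin n) (Fin n) 𝕜} (hA : A.IsHermitian) : spread A ≤ K * stretch A := by
  rcases Nat.eq_zero_or_pos n with rfl | hn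
  · have h1 : traceValues A = {0} := by
      rw [traceValues, ← (correlation_nonempty 𝕜 0).image_const 0]
      exact Set.image_congr fun X _ => by simp [Matrix.trace]
    have h2 : quadValues A = {0} := by
      rw [quadValues, ← (unimodular_nonempty 𝕜 0).image_const 0]
      exact Set.image_congr fun X _ => by simp
    simp [spread, stretch, h1, h2]
  set M := sSup (quadValues A) with hM
  set m := sInf (quadValues A) with hm
  set c := (M + m) / 2 with hc
  -- Only the trace `-c` of the shift matters; spreading it evenly requires `n > 0`.
  set D : Fin n → ℝ := fun _ => -c / n
  have hDsum : ∑ i, D i = -c := by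
    have : (n : ℝ) ≠ 0 := by positivity
    simp [D]; field_simp
  set B := A + Matrix.diagonal fun i => (D i : 𝕜)
  have hB : B.IsHermitian := hA.add (isHermitian_diagonal_ofReal _)
  have hθ : thetaSeminorm B ≤ (M - m) / 2 := by
    obtain ⟨x, hx, h⟩ := (isGreatest_thetaValues B).1
    simp only [sum_sum_eq_dotProduct, dotProduct_mulVec_eq_quadForm hB, RCLike.norm_ofReal] at h
    have hxA : quadForm A x ∈ quadValues A := ⟨x, hx, rfl⟩
    have h1 : quadForm A x ≤ M := (isGreatest_quadValues A).2 hxA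
    have h2 : m ≤ quadForm A x := (isLeast_quadValues A).2 hxA
    rw [quadForm_add_diagonal] at h
    simp only [show ∀ i, ‖x i‖ = 1 from hx, one_pow, mul_one, hDsum] at h
    rw [← h, abs_le]
    constructor <;> linarith
  have hγ : gammaSeminorm n B ≤ K * ((M - m) / 2) :=
    (hK n n le_rfl B hB).trans (mul_le_mul_of_nonneg_left hθ
      (zero_le_one.trans (one_le_of_mem_grothendieckConstants hK)))
  have htr : ∀ v ∈ traceValues A, |v - c| ≤ K * ((M - m) / 2) := by
    rintro _ ⟨X, hX, rfl⟩
    refine le_trans (le_of_eq ?_) ((re_trace_le_gammaSeminorm B hX).trans hγ)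
    have h : (Matrix.diagonal (fun i => (D i : 𝕜)) * X).trace = ((∑ i, D i : ℝ) : 𝕜) := by
      simp [Matrix.trace, Matrix.diagonal_mul, hX.2]
    simp only [B, Matrix.add_mul, Matrix.trace_add, map_add, h, RCLike.ofReal_re, hDsum,
      sub_eq_add_neg]
  have h1 := abs_le.mp (htr _ (isGreatest_traceValues A).1)
  have h2 := abs_le.mp (htr _ (isLeast_traceValues A).1)
  have h3 : stretch A = M - m := rfl
  rw [h3, spread]
  linarith [h1.2, h2.1]

end SymGrothendieck

end

theorem mainTheorem6 (𝕜 : Type*) [RCLike 𝕜] :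
    IsLeast (SymGrothendieck.grothendieckConstants 𝕜) (SymGrothendieck.Kγ 𝕜) ∧
    ∀ (n : ℕ) (A : Matrix (Fin n) (Fin n) 𝕜), A.IsHermitian →
      SymGrothendieck.stretch A ≤ SymGrothendieck.spread A ∧
      SymGrothendieck.spread A ≤ SymGrothendieck.Kγ 𝕜 * SymGrothendieck.stretch A :=
  ⟨SymGrothendieck.isLeast_Kγ, fun _ A hA => ⟨SymGrothendieck.stretch_le_spread A,
    SymGrothendieck.spread_le_mul_stretch SymGrothendieck.isLeast_Kγ.1 hA⟩⟩
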